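/- Let $F$ be a finite field, $k \in \mathbb N = \{0,1,2,\dots\}$, and let $B$ be a left module over a unital (not necessarily commutative) ring $R$ such that $|F|$ is invertible in $R$. The $n$-ary operations from a set $A$ to a set $B$ are the functions $A^n \to B$, $n \in \mathbb N$ (arity $0$ is allowed). The term clone $\mathrm{Clo}(A)$ of a module $A$ is the smallest set of operations on $A$ that contains all projections and the operations $0,\,-x,\,x+y,\,rx$ ($r$ a scalar) and is closed under composition. A clonoid from $F^k$ to $B$ is a set $\mathcal C$ of operations from $F^k$ to $B$ such that $g\circ(f_1,\dots,f_n) \in \mathcal C$ for all $k'$-ary $f_1,\dots,f_n\in\mathcal C$ and $n$-ary $g \in \mathrm{Clo}(B)$, and $f\circ(g_1,\dots,g_n) \in \mathcal C$ for all $n$-ary $f \in \mathcal C$ and $k'$-ary $g_1,\dots,g_n \in \mathrm{Clo}(F^k)$, for all $n,k'\in\mathbb N$. Clonoids from $F^k$ to $B$ form a lattice under inclusion. For $0 \le i \le k$ let $M_{i,k}(F,B)$ be the $R[\mathrm{GL}_i(F)]$-module of all functions $f\colon\{X\in F^{i\times k} \mid \mathrm{rk}(X)=i\}\to B$, with action $\big(\big(\sum_{M}\alpha_M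 M\big) f\big)(X)=\sum_{M}\alpha_M f(M^{-1}X)$ (so that a subset is a submodule if and only if it is an additive subgroup closed under $f \mapsto r f(M\,\cdot)$ for all $r\in R$, $M\in \mathrm{GL}_i(F)$; for $i=0$ this is the $R$-module $B$), and let $\mathrm{Sub}(M_{i,k}(F,B))$ be its lattice of submodules. Then there is a lattice isomorphism $$\Phi\colon \{\text{clonoids from } F^k \text{ to } B\}\;\longrightarrow\;\prod_{i=0}^k \mathrm{Sub}(M_{i,k}(F,B))$$ such that, for every $0\le j\le k$, the sublattice $\prod_{i=0}^j \mathrm{Sub}(M_{i,k}(F,B))$ (the tuples whose entries with index $i>j$ are $0$) corresponds under $\Phi$ exactly to those clonoids $\mathcal C$ all of whose members are generated by their $j$-ary minors, i.e. such that every $l$-ary $f\in\mathcal C$ lies in the smallest clonoid from $F^k$ to $B$ that contains all the $j$-ary operations $f\circ(v_1,\dots,v_l)$ with $j$-ary $v_1,\dots,v_l\in \mathrm{Clo}(F^k)$. -/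

import Mathlib

open scoped MatrixGroups

/-! ### Finitary operations, clones and term clones -/

/-- The `n`-ary operations from `A` to `B`; arities are all natural numbers, including `0`. -/
abbrev Op (A B : Type*) (n : ℕ) := (Fin n → A) → B

/-- The composition `f ∘ (g₁, …, gₙ)` of an `n`-ary operation with `n` operations of arity `k`. -/
def Op.comp {A B C : Type*} {n k : ℕ} (f : Op B C n) (g : Fin n → Op A B k) : Op A C k :=
  fun x => f fun i => g i x

/-- A set of finitary operations from `A` to `B`, given by its `n`-ary parts. -/
abbrev OpSet (A B : Type*) := ∀ n : ℕ, Set (Op A B n)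

/-- A clone on `A`: contains the projections and is closed under composition. -/
structure Clone (A : Type*) where
  ops : OpSet A A
  proj_mem : ∀ (n : ℕ) (i : Fin n), (fun x => x i) ∈ ops n
  comp_mem : ∀ (n k : ℕ) (f : Op A A n) (g : Fin n → Op A A k),
    f ∈ ops n → (∀ i, g i ∈ ops k) → f.comp g ∈ ops k

/-- The smallest clone containing a set `S` of operations. -/
def Clone.generate {A : Type*} (S : OpSet A A) : Clone A where
  ops n := {f | ∀ C : Clone A, (∀ m, S m ⊆ C.ops m) → f ∈ C.ops n}
  proj_mem n i := fun C _ => C.proj_mem n i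
  comp_mem n k f g hf hg := fun C hC => C.comp_mem n k f g (hf C hC) fun i => hg i C hC

/-- The basic operations `0, -, +` and `x ↦ r x` (for `r ∈ R`) of a (left) `R`-module `A`,
seen as an algebra. -/
inductive ModuleBasicOp (R A : Type*) [Ring R] [AddCommGroup A] [Module R A] :
    ∀ n : ℕ, Op A A n → Prop
  | zero : ModuleBasicOp R A 0 (fun _ => 0)
  | neg : ModuleBasicOp R A 1 (fun x => -x 0)
  | add : ModuleBasicOp R A 2 (fun x => x 0 + x 1)
  | smul (r : R) : ModuleBasicOp R A 1 (fun x => r • x 0)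

/-- The term clone of the `R`-module `A`. -/
def termClone (R A : Type*) [Ring R] [AddCommGroup A] [Module R A] : Clone A :=
  Clone.generate fun n => {f | ModuleBasicOp R A n f}

/-- The term operations of a module are exactly the linear combinations of the arguments. -/
theorem mem_termClone_iff (R A : Type*) [Ring R] [AddCommGroup A] [Module R A] (n : ℕ)
    (f : Op A A n) :
    f ∈ (termClone R A).ops n ↔ ∃ r : Fin n → R, ∀ x, f x = ∑ i, r i • x i := by
  constructor
  · intro hf
    refine hf
      { ops := fun n => {f | ∃ r : Fin n → R, ∀ x, f x = ∑ i, r i • x i}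
        proj_mem := ?_
        comp_mem := ?_ } ?_
    · intro n i
      exact ⟨Pi.single i 1, fun x => by simp [Pi.single_apply, ite_smul]⟩
    · rintro n k f g ⟨r, hr⟩ hg
      choose s hs using hg
      refine ⟨fun j => ∑ i, r i * s i j, fun x => ?_⟩
      simp only [Op.comp, hr, hs, Finset.smul_sum, Finset.sum_smul, mul_smul]
      exact Finset.sum_comm
    · rintro m f (_ | _ | _ | r)
      · exact ⟨0, fun x => by simp⟩
      · exact ⟨fun _ => -1, fun x => by simp⟩
      · exact ⟨fun _ => 1, fun x => by simp [Fin.sum_univ_two]⟩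
      · exact ⟨fun _ => r, fun x => by simp⟩
  · rintro ⟨r, hr⟩ C hC
    have h0 : ∀ k, (fun _ => 0 : Op A A k) ∈ C.ops k := fun k =>
      C.comp_mem 0 k _ (fun i => i.elim0) (hC 0 ModuleBasicOp.zero) (fun i => i.elim0)
    have key : ∀ s : Finset (Fin n), (fun x => ∑ i ∈ s, r i • x i : Op A A n) ∈ C.ops n := by
      intro s
      induction s using Finset.induction_on with
      | empty => simpa using h0 n
      | insert a s ha ih =>
        have h1 : (fun x => r a • x a : Op A A n) ∈ C.ops n :=
          C.comp_mem 1 n _ (fun _ x => x a) (hC 1 (ModuleBasicOp.smul (r a)))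
            (fun _ => C.proj_mem n a)
        have h2 := C.comp_mem 2 n _ ![fun x => r a • x a, fun x => ∑ i ∈ s, r i • x i]
          (hC 2 ModuleBasicOp.add) (by intro i; fin_cases i <;> [exact h1; exact ih])
        simp only [Finset.sum_insert ha]
        exact h2
    have := key Finset.univ
    rwa [show f = fun x => ∑ i, r i • x i from funext hr]

/-! ### Clonoids -/

/-- A clonoid from the clone `𝒜` on `A` to the clone `ℬ` on `B`. -/
@[ext]
structure Clonoid {A B : Type*} (𝒜 : Clone A) (ℬ : Clone B) where
  ops : OpSet A B
  comp_left : ∀ (n k : ℕ) (g : Op B B n) (f : Fin n → Op A B k),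
    g ∈ ℬ.ops n → (∀ i, f i ∈ ops k) → g.comp f ∈ ops k
  comp_right : ∀ (n k : ℕ) (f : Op A B k) (g : Fin k → Op A A n),
    f ∈ ops k → (∀ i, g i ∈ 𝒜.ops n) → f.comp g ∈ ops n

namespace Clonoid

variable {A B : Type*} {𝒜 : Clone A} {ℬ : Clone B}

/-- The smallest clonoid from `𝒜` to `ℬ` containing a set `S` of operations. -/
def generate (𝒜 : Clone A) (ℬ : Clone B) (S : OpSet A B) : Clonoid 𝒜 ℬ where
  ops n := {f | ∀ C : Clonoid 𝒜 ℬ, (∀ m, S m ⊆ C.ops m) → f ∈ C.ops n}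
  comp_left n k g f hg hf := fun C hC => C.comp_left n k g f hg fun i => hf i C hC
  comp_right n k f g hf hg := fun C hC => C.comp_right n k f g (hf C hC) hg

/-- Clonoids are ordered by inclusion. -/
instance : PartialOrder (Clonoid 𝒜 ℬ) where
  le C D := ∀ n, C.ops n ⊆ D.ops n
  le_refl _ _ := subset_rfl
  le_trans _ _ _ h h' n := (h n).trans (h' n)
  le_antisymm _ _ h h' := Clonoid.ext (funext fun n => (h n).antisymm (h' n))

/-- The lattice of clonoids: meets are intersections, joins are generated by unions. -/
instance : Lattice (Clonoid 𝒜 ℬ) where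
  inf C D :=
    { ops := fun n => C.ops n ∩ D.ops n
      comp_left := fun n k g f hg hf =>
        ⟨C.comp_left n k g f hg fun i => (hf i).1, D.comp_left n k g f hg fun i => (hf i).2⟩
      comp_right := fun n k f g hf hg =>
        ⟨C.comp_right n k f g hf.1 hg, D.comp_right n k f g hf.2 hg⟩ }
  sup C D := generate 𝒜 ℬ fun n => C.ops n ∪ D.ops n
  inf_le_left _ _ _ := Set.inter_subset_left
  inf_le_right _ _ _ := Set.inter_subset_right
  le_inf _ _ _ h h' n := Set.subset_inter (h n) (h' n)
  le_sup_left _ _ n _ hf := fun _ hE => hE n (Or.inl hf)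
  le_sup_right _ _ n _ hf := fun _ hE => hE n (Or.inr hf)
  sup_le _ _ E h h' _ _ hf := hf E fun m => Set.union_subset (h m) (h' m)

end Clonoid

/-- The `j`-ary `(𝒜, ℬ)`-minors `f ∘ (v₁, …, vₗ)`, `vᵢ ∈ 𝒜` of arity `j`, of the operation `f`,
as a set of operations all of whose elements have arity `j`. -/
def minors {A B : Type*} (𝒜 : Clone A) (j : ℕ) {l : ℕ} (f : Op A B l) : OpSet A B :=
  fun m => {g | m = j ∧ ∃ v : Fin l → Op A A m, (∀ i, v i ∈ 𝒜.ops m) ∧ g = f.comp v}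

/-- The operation `f` is generated by its `j`-ary `(𝒜, ℬ)`-minors. -/
def GeneratedByMinors {A B : Type*} (𝒜 : Clone A) (ℬ : Clone B) (j : ℕ) {l : ℕ}
    (f : Op A B l) : Prop :=
  f ∈ (Clonoid.generate 𝒜 ℬ (minors 𝒜 j f)).ops l

/-! ### The modules of functions on full rank matrices -/

/-- The `i × k` matrices over `F` of rank `i`. -/
abbrev FullRankMatrix (F : Type*) [Field F] (i k : ℕ) :=
  {X : Matrix (Fin i) (Fin k) F // X.rank = i}

/-- Invertible matrices act on full rank matrices by left multiplication. -/
def FullRankMatrix.mulLeft {F : Type*} [Field F] {i k : ℕ} (M : GL (Fin i) F)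
    (X : FullRankMatrix F i k) : FullRankMatrix F i k :=
  ⟨(M : Matrix (Fin i) (Fin i) F) * X.1, by
    rw [Matrix.rank_mul_eq_right_of_isUnit_det _ _ (M.isUnit.map Matrix.detMonoidHom), X.2]⟩

/-- All functions from the full rank `i × k` matrices over `F` to `B`. -/
def FullRankFun (F : Type*) [Field F] (B : Type*) (i k : ℕ) := FullRankMatrix F i k → B

namespace FullRankFun

variable {F : Type*} [Field F] {R : Type*} [Ring R] {B : Type*} [AddCommGroup B] [Module R B]
  {i k : ℕ}

instance : AddCommGroup (FullRankFun F B i k) :=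
  inferInstanceAs (AddCommGroup (FullRankMatrix F i k → B))

instance : Module R (FullRankFun F B i k) :=
  inferInstanceAs (Module R (FullRankMatrix F i k → B))

/-- The left action `(M • f)(X) = f (M⁻¹ X)` of the general linear group. -/
instance : DistribMulAction (GL (Fin i) F) (FullRankFun F B i k) where
  smul M f := fun X => f (X.mulLeft M⁻¹)
  one_smul f := funext fun X => congrArg f (Subtype.ext (by simp [FullRankMatrix.mulLeft]))
  mul_smul M N f := funext fun X => congrArg f (Subtype.ext (by
    simp [FullRankMatrix.mulLeft, mul_inv_rev, Matrix.mul_assoc]))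
  smul_zero _ := rfl
  smul_add _ _ _ := rfl

/-- The module structure over the group ring `R[GL_i(F)]`,
`((∑ α_M M) • f)(X) = ∑ α_M f (M⁻¹ X)`. -/
noncomputable instance :
    Module (MonoidAlgebra R (GL (Fin i) F)) (FullRankFun F B i k) :=
  Module.compHom _ (MonoidAlgebra.liftNCRingHom
    (Module.toAddMonoidEnd R (FullRankFun F B i k))
    (DistribMulAction.toAddMonoidEnd (GL (Fin i) F) (FullRankFun F B i k))
    (fun _ _ => AddMonoidHom.ext fun _ => rfl))

theorem single_smul_apply (M : GL (Fin i) F) (r : R) (f : FullRankFun F B i k)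
    (X : FullRankMatrix F i k) :
    ((MonoidAlgebra.single M r : MonoidAlgebra R (GL (Fin i) F)) • f) X
      = r • f (X.mulLeft M⁻¹) := by
  change (MonoidAlgebra.liftNC _ _ (MonoidAlgebra.single M r) : AddMonoid.End _) f X = _
  rw [MonoidAlgebra.liftNC_single]
  rfl

/-- An additive subgroup of functions is (the carrier of) an `R[GL_i(F)]`-submodule if and only if
it contains, with `f`, all the functions `X ↦ r • f (M X)`. -/
theorem exists_submodule_iff (S : AddSubgroup (FullRankFun F B i k)) :
    (∃ N : Submodule (MonoidAlgebra R (GL (Fin i) F)) (FullRankFun F B i k),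
        N.toAddSubgroup = S) ↔
      ∀ (r : R) (M : GL (Fin i) F), ∀ f ∈ S, (fun X => r • f (X.mulLeft M)) ∈ S := by
  have h1 : ∀ (r : R) (M : GL (Fin i) F) (f : FullRankFun F B i k),
      (fun X => r • f (X.mulLeft M) : FullRankFun F B i k)
        = (MonoidAlgebra.single M⁻¹ r : MonoidAlgebra R (GL (Fin i) F)) • f := by
    intro r M f
    funext X
    rw [single_smul_apply, inv_inv]
  constructor
  · rintro ⟨N, rfl⟩ r M f hf
    rw [h1]
    exact N.smul_mem _ hf
  · intro h
    refine ⟨{ S with smul_mem' := fun a f hf => ?_ }, rfl⟩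
    induction a using MonoidAlgebra.induction_linear with
    | zero => rw [zero_smul]; exact S.zero_mem
    | add a b ha hb => rw [add_smul]; exact S.add_mem ha hb
    | single M r =>
      have := h r M⁻¹ f hf
      rwa [h1, inv_inv] at this

end FullRankFun

/-!
The `n`-ary operations from `F ^ k` to `B` are the functions `f` of an `n × k` matrix `X` whose
rows are the arguments, and a clonoid is the same thing as a family of `R`-submodules, one for each
arity, that is closed under the substitutions `f ↦ f (A X)` for all matrices `A`
(`Clonoid.toSubmodule`, `Clonoid.precomp_mem`, `Clonoid.ofSubmodules`). Call an `n`-ary operation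
primitive if it vanishes on all matrices of rank less than `n`. Primitive operations of arity `i`
correspond to functions on the full rank `i × k` matrices, and the isomorphism sends a clonoid to
the tuple of its sets of primitive operations of arity `0, …, k` (`Clonoid.primitivePart`).

The main ingredient is a theorem of Kovács on the semigroup algebra of `n × n` matrices over a
commutative ring `S` in which `|F|` is invertible: there is an element `u`, equal to the identity
up to singular matrices, with `u A = 0` for every matrix `A` of rank less than `n`
(`Kovacs.exists_mul_eq_zero`); transposing, there is such an element with `A u = 0` instead. It is
used for `S` the center of `R`, so that `u` acts `R`-linearly on operations. To construct `u`, the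
identity of a space `V` is decomposed into pieces `a W`, one for each subspace `W`, where `a W` is
a combination of endomorphisms with image in `W` and vanishes on every subspace that does not
contain `W`. The restriction of `a W` to `W` has to be the identity minus the smaller pieces, and
`a W` is obtained from this restriction by averaging over all extensions to `V` of the
endomorphisms of `W` that occur; then `u = a ⊤`. The average over extensions makes `a W` vanish on
a subspace `U` that does not contain `W`, because there it depends only on the restriction to
`U ⊓ W`, which is zero by induction (`Kovacs.piece_comp_eq_zero`).

If `u A = 0` for all `A` of deficient rank, then `f ↦ u f` maps every clonoid to itself and produces
primitive operations, while `f - u f` is a combination of operations `f (M X)` with `M` singular,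
which come from smaller arities. By induction on the arity a clonoid is determined by its primitive
parts (`Clonoid.le_of_primitivePart_le`). If `A u = 0` instead, then `u` fixes the primitive
operations of its arity and kills everything that comes from primitive operations of another arity,
so that arbitrary primitive parts can be prescribed (`Clonoid.exists_primitivePart_eq`).

Finally, a primitive operation of arity greater than `j` has only zero as a `j`-ary minor.
Conversely, let all primitive parts of arity greater than `j` be zero. The minors of `f` of arity at most `j`
all come from its `j`-ary minors, so the comparison of primitive parts shows that `f` is generated
by them.
-/

/-! ### The annihilator of the singular matrices in the semigroup algebra -/

namespace Kovacs

variable {F V : Type*} [Field F] [AddCommGroup V] [Module F V]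

theorem exists_projection (W : Submodule F V) :
    ∃ P : Module.End F V, (∀ w ∈ W, P w = w) ∧ ∀ v, P v ∈ W := by
  obtain ⟨g, hg⟩ := W.subtype.exists_leftInverse_of_injective W.ker_subtype
  exact ⟨W.subtype ∘ₗ g, fun w hw => congrArg Subtype.val (LinearMap.congr_fun hg ⟨w, hw⟩),
    fun v => (g v).2⟩

/-- A linear projection of `V` onto the subspace `W`. -/
noncomputable def proj (W : Submodule F V) : Module.End F V := (exists_projection W).choose

theorem proj_of_mem {W : Submodule F V} {w : V} (hw : w ∈ W) : proj W w = w :=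
  (exists_projection W).choose_spec.1 w hw

theorem proj_mem (W : Submodule F V) (v : V) : proj W v ∈ W :=
  (exists_projection W).choose_spec.2 v

/-- The endomorphisms of `V` that vanish on `W` and map `V` into `W`: the differences of two
extensions to `V` of the same endomorphism of `W`. -/
def extDiff (W : Submodule F V) : Submodule F (Module.End F V) where
  carrier := {Z | (∀ w ∈ W, Z w = 0) ∧ ∀ v, Z v ∈ W}
  zero_mem' := ⟨fun _ _ => rfl, fun _ => W.zero_mem⟩
  add_mem' := fun ha hb => ⟨fun w hw => by simp [ha.1 w hw, hb.1 w hw],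
    fun v => W.add_mem (ha.2 v) (hb.2 v)⟩
  smul_mem' := fun c a ha => ⟨fun w hw => by simp [ha.1 w hw], fun v => W.smul_mem c (ha.2 v)⟩

variable {S : Type*} [CommRing S]

/-- The average of the extensions to `V` of an endomorphism `M` of `W`, extended linearly to formal
combinations of endomorphisms. The endomorphism of `W` is given as the restriction of an
endomorphism of `V`; the extensions are then `M ∘ proj W + Z` with `Z` in `extDiff W`. -/
noncomputable def avgExtend (W : Submodule F V) (x : Module.End F V →₀ S) :
    Module.End F V →₀ S :=
  Ring.inverse (Nat.card (extDiff W) : S) •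
    ∑ᶠ Z : extDiff W, x.mapDomain fun M => M * proj W + (Z : Module.End F V)

/-- The formal combination of endomorphisms of `V` with image in `W` obtained by averaging the
extensions of the element of the semigroup algebra of `End W` that annihilates all singular
endomorphisms of `W`. For `W = ⊤` it is that annihilating element itself. -/
noncomputable def piece [FiniteDimensional F V] (S : Type*) [CommRing S] (W : Submodule F V) :
    Module.End F V →₀ S :=
  avgExtend W (Finsupp.single 1 1 - ∑ᶠ W' : {W' : Submodule F V // W' < W}, piece S W'.1)
termination_by Module.finrank F W
decreasing_by exact Submodule.finrank_lt_finrank_of_lt W'.2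

/-- The identity minus the pieces of the proper subspaces of `W`. Its restriction to `W` is the
element that annihilates all singular endomorphisms of `W`. -/
noncomputable def remainder [FiniteDimensional F V] (S : Type*) [CommRing S]
    (W : Submodule F V) : Module.End F V →₀ S :=
  Finsupp.single 1 1 - ∑ᶠ W' : {W' : Submodule F V // W' < W}, piece S W'.1

theorem piece_eq [FiniteDimensional F V] (W : Submodule F V) :
    piece S W = avgExtend W (remainder S W) := by
  rw [piece, remainder]

theorem exists_of_mem_support_finsum {ι α : Type*} [Finite ι] {f : ι → α →₀ S} {a : α}
    (h : a ∈ (∑ᶠ i, f i).support) : ∃ i, a ∈ (f i).support := by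
  classical
  have := Fintype.ofFinite ι
  rw [finsum_eq_sum_of_fintype] at h
  simpa using Finsupp.support_finsetSum h

theorem mapDomain_finsum {ι α β : Type*} [Finite ι] (f : ι → α →₀ S) (g : α → β) :
    (∑ᶠ i, f i).mapDomain g = ∑ᶠ i, (f i).mapDomain g := by
  have := Fintype.ofFinite ι
  rw [finsum_eq_sum_of_fintype, finsum_eq_sum_of_fintype, Finsupp.mapDomain_finsetSum]

theorem exists_of_mem_support_mapDomain {α β : Type*} {f : α → β} {x : α →₀ S} {b : β}
    (h : b ∈ (x.mapDomain f).support) : ∃ a ∈ x.support, f a = b := by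
  classical
  simpa using Finsupp.mapDomain_support h

section Finite

variable [Finite F] [FiniteDimensional F V]

instance finite_end : Finite (Module.End F V) := Module.finite_of_finite F

instance finite_submodule : Finite (Submodule F V) :=
  have : Finite V := Module.finite_of_finite F
  Finite.of_injective _ SetLike.coe_injective

theorem exists_of_mem_support_avgExtend {W : Submodule F V} {x : Module.End F V →₀ S}
    {N : Module.End F V} (h : N ∈ (avgExtend W x).support) :
    ∃ M ∈ x.support, ∃ Z ∈ extDiff W, N = M * proj W + Z := by
  obtain ⟨Z, hZ⟩ := exists_of_mem_support_finsum (Finsupp.support_smul h)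
  obtain ⟨M, hM, rfl⟩ := exists_of_mem_support_mapDomain hZ
  exact ⟨M, hM, Z, Z.2, rfl⟩

theorem mapDomain_avgExtend {β : Type*} (W : Submodule F V) (x : Module.End F V →₀ S)
    (g : Module.End F V → β) :
    (avgExtend W x).mapDomain g = Ring.inverse (Nat.card (extDiff W) : S) •
      ∑ᶠ Z : extDiff W, x.mapDomain fun M => g (M * proj W + (Z : Module.End F V)) := by
  rw [avgExtend, Finsupp.mapDomain_smul, mapDomain_finsum]
  simp only [← Finsupp.mapDomain_comp]
  rfl

/-- Averaging is invisible after restriction to a subspace of `W`. -/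
theorem mapDomain_avgExtend_of_le (hF : IsUnit (Nat.card F : S)) {U : Type*} [AddCommGroup U]
    [Module F U] {W : Submodule F V} (x : Module.End F V →₀ S) {A : U →ₗ[F] V}
    (hA : LinearMap.range A ≤ W) :
    (avgExtend W x).mapDomain (fun M => M ∘ₗ A) = x.mapDomain fun M => M ∘ₗ A := by
  have hu : ∀ u, A u ∈ W := fun u => hA ⟨u, rfl⟩
  have key : ∀ (Z : extDiff W) (M : Module.End F V),
      (M * proj W + (Z : Module.End F V)) ∘ₗ A = M ∘ₗ A := by
    intro Z M
    ext u
    simp [proj_of_mem (hu u), Z.2.1 _ (hu u)]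
  have hcard : IsUnit (Nat.card (extDiff W) : S) := by
    rw [Module.natCard_eq_pow_finrank (K := F), Nat.cast_pow]
    exact hF.pow _
  have := Fintype.ofFinite (extDiff W)
  rw [mapDomain_avgExtend]
  simp only [key]
  rw [finsum_eq_sum_of_fintype, Finset.sum_const, Finset.card_univ, ← Nat.card_eq_fintype_card,
    ← Nat.cast_smul_eq_nsmul S, smul_smul, Ring.inverse_mul_cancel _ hcard, one_smul]

/-- After averaging, restriction to the range of `A` only depends on the restriction to
the part of the range of `A` that lies in `W`. -/
theorem mapDomain_avgExtend_proj {U : Type*} [AddCommGroup U] [Module F U] {W : Submodule F V}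
    {x : Module.End F V →₀ S} (hx : ∀ M ∈ x.support, ∀ w ∈ W, M w ∈ W) (A : U →ₗ[F] V) :
    (avgExtend W x).mapDomain (fun M => M ∘ₗ A) =
      (avgExtend W (x.mapDomain fun M => M * proj (W ⊓ LinearMap.range A))).mapDomain
        fun M => M ∘ₗ A := by
  set D := W ⊓ LinearMap.range A with hD
  have := Fintype.ofFinite (extDiff W)
  rw [mapDomain_avgExtend, mapDomain_avgExtend]
  congr 1
  simp only [← Finsupp.mapDomain_comp]
  rw [finsum_eq_sum_of_fintype, finsum_eq_sum_of_fintype]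
  simp only [Finsupp.mapDomain, Finsupp.sum]
  rw [Finset.sum_comm, Finset.sum_comm (s := Finset.univ)]
  refine Finset.sum_congr rfl fun M hM => ?_
  -- A complement of `D` in the range of `A` extends to a complement `K` of `W`; projecting
  -- to `K` along `W` gives an element of `extDiff W` that corrects the difference.
  obtain ⟨D', hD', hDD'⟩ : ∃ D', D ⊔ D' = LinearMap.range A ∧ Disjoint D D' := by
    obtain ⟨E, hE⟩ := Submodule.exists_isCompl D
    refine ⟨E ⊓ LinearMap.range A, ?_, hE.disjoint.mono_right inf_le_left⟩
    rw [← sup_inf_assoc_of_le _ (inf_le_right : D ≤ LinearMap.range A), hE.sup_eq_top, top_inf_eq]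
  have hle : D' ≤ LinearMap.range A := hD' ▸ le_sup_right
  have hWD : Disjoint W D' := by
    rw [disjoint_iff_inf_le] at hDD' ⊢
    exact fun v hv => hDD' ⟨⟨hv.1, hle hv.2⟩, hv.2⟩
  obtain ⟨K, hK, hKW⟩ := hWD.symm.exists_isCompl
  set Q : Module.End F V := K.projection W hKW with hQ
  set Y : Module.End F V := M * proj W - M * proj D * proj W with hY
  have hYW : ∀ v, Y v ∈ W := fun v =>
    W.sub_mem (hx M hM _ (proj_mem W v)) (hx M hM _ (inf_le_left (a := W) (proj_mem D _)))
  have hYD : ∀ v ∈ D, Y v = 0 := fun v hv => by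
    simp [hY, proj_of_mem (inf_le_left (a := W) hv), proj_of_mem hv]
  have hZ : Y * Q ∈ extDiff W := by
    refine ⟨fun w hw => ?_, fun v => hYW _⟩
    have : Q w = 0 := by simpa [hQ] using hw
    simp [this]
  have hYA : (Y * Q) ∘ₗ A = Y ∘ₗ A := by
    ext u
    obtain ⟨d, hd, d', hd', h⟩ := Submodule.mem_sup.1
      (show A u ∈ D ⊔ D' from hD'.symm ▸ (⟨u, rfl⟩ : A u ∈ LinearMap.range A))
    have h1 : Q d = 0 := by simpa [hQ] using inf_le_left (a := W) hd
    have h2 : Q d' = d' := by simpa [hQ] using hK hd'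
    simp [← h, h1, h2, hYD d hd]
  refine Fintype.sum_equiv (Equiv.addRight ⟨Y * Q, hZ⟩) _ _ fun Z => ?_
  congr 1
  have : M * proj W = Y + M * proj D * proj W := by rw [hY]; abel
  simp only [Function.comp, this, LinearMap.add_comp, Equiv.coe_addRight, Submodule.coe_add, hYA]
  abel

theorem mem_support_remainder {W : Submodule F V} {M : Module.End F V}
    (hM : M ∈ (remainder S W).support) : M = 1 ∨ ∃ W' < W, M ∈ (piece S W').support := by
  classical
  rcases Finset.mem_union.1 (Finsupp.support_sub hM) with h | h
  · exact Or.inl (Finset.mem_singleton.1 (Finsupp.support_single_subset h))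
  · obtain ⟨W', hW'⟩ := exists_of_mem_support_finsum h
    exact Or.inr ⟨W'.1, W'.2, hW'⟩

theorem mem_of_mem_support_piece (W : Submodule F V) :
    ∀ M ∈ (piece S W).support, ∀ v, M v ∈ W := by
  induction W using WellFoundedLT.induction with
  | ind W ih =>
  intro N hN v
  rw [piece_eq] at hN
  obtain ⟨M, hM, Z, hZ, rfl⟩ := exists_of_mem_support_avgExtend hN
  refine W.add_mem ?_ (hZ.2 v)
  rcases mem_support_remainder hM with rfl | ⟨W', hW', h⟩
  · exact proj_mem W v
  · exact hW'.le (ih W' hW' M h _)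

theorem remainder_map_mem {W : Submodule F V} {M : Module.End F V}
    (hM : M ∈ (remainder S W).support) (w : V) (hw : w ∈ W) : M w ∈ W := by
  rcases mem_support_remainder hM with rfl | ⟨W', hW', h⟩
  · exact hw
  · exact hW'.le (mem_of_mem_support_piece W' M h w)

theorem mapDomain_remainder {W : Submodule F V} {β : Type*} (g : Module.End F V → β) :
    (remainder S W).mapDomain g = Finsupp.single (g 1) 1 -
      ∑ᶠ W' : {W' : Submodule F V // W' < W}, (piece S W'.1).mapDomain g := by
  rw [remainder, Finsupp.mapDomain_sub, Finsupp.mapDomain_single, mapDomain_finsum]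

/-- The induction step of `piece_comp_eq_zero`. The hypothesis is only needed for endomorphisms of
`V`, whereas the conclusion holds for maps from a space in any universe. -/
theorem piece_comp_eq_zero_of_forall_lt (hF : IsUnit (Nat.card F : S)) {U : Type*}
    [AddCommGroup U] [Module F U] (A : U →ₗ[F] V) {W : Submodule F V}
    (hA : ¬ W ≤ LinearMap.range A)
    (ih : ∀ W' < W, ∀ Q : Module.End F V, ¬ W' ≤ LinearMap.range Q →
      (piece S W').mapDomain (fun M => M ∘ₗ Q) = 0) :
    (piece S W).mapDomain (fun M => M ∘ₗ A) = 0 := by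
  set D := W ⊓ LinearMap.range A with hD
  have hDW : D < W := inf_le_left.lt_of_ne fun h => hA (h ▸ inf_le_right)
  have hrange : LinearMap.range (proj D) = D := by
    ext v
    exact ⟨fun ⟨w, hw⟩ => hw ▸ proj_mem D w, fun hv => ⟨v, proj_of_mem hv⟩⟩
  suffices h : (remainder S W).mapDomain (fun M => M * proj D) = 0 by
    rw [piece_eq, mapDomain_avgExtend_proj (fun M hM => remainder_map_mem hM), ← hD, h,
      mapDomain_avgExtend]
    simp
  -- The piece of `D` acts on `D` as the identity minus the pieces strictly below `D`.
  have h1 : (piece S D).mapDomain (fun M => M * proj D) =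
      (remainder S D).mapDomain (fun M => M * proj D) := by
    rw [piece_eq]
    exact mapDomain_avgExtend_of_le hF _ hrange.le
  have h2 : ∀ W₀ : Submodule F V, (∑ᶠ W' : {W' : Submodule F V // W' < W₀},
      (piece S W'.1).mapDomain fun M => M * proj D) =
        ∑ᶠ W' ∈ Set.Iio W₀, (piece S W').mapDomain fun M => M * proj D := fun W₀ =>
    finsum_subtype_eq_finsum_cond
      (f := fun W' : Submodule F V => (piece S W').mapDomain fun M => M * proj D) (· < W₀)
  -- By hypothesis, only the pieces of subspaces of `D` contribute to the sum over `W' < W`.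
  rw [mapDomain_remainder, h2] at h1 ⊢
  rw [sub_eq_zero, finsum_mem_inter_support_eq' _ (Set.Iio W) (Set.Iic D), ← Set.Iio_insert,
    finsum_mem_insert _ Set.self_notMem_Iio (Set.toFinite _), h1, sub_add_cancel]
  intro W' hW'
  refine ⟨fun h => ?_, fun h => hDW.trans_le' h⟩
  by_contra hWD
  exact hW' (ih W' h (proj D) (by rwa [hrange]))

/-- The piece of `W` vanishes on every subspace that does not contain `W`. By induction, this
reduces to the decomposition of the identity of `W ⊓ range A` into the smaller pieces. -/
theorem piece_comp_eq_zero (hF : IsUnit (Nat.card F : S)) {U : Type*} [AddCommGroup U]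
    [Module F U] (A : U →ₗ[F] V) (W : Submodule F V) (hA : ¬ W ≤ LinearMap.range A) :
    (piece S W).mapDomain (fun M => M ∘ₗ A) = 0 := by
  refine piece_comp_eq_zero_of_forall_lt hF A hA fun W' _ => ?_
  induction W' using WellFoundedLT.induction with
  | ind W' ih =>
  exact fun Q hQ => piece_comp_eq_zero_of_forall_lt hF Q hQ fun W'' h =>
    ih W'' h (h.trans ‹_›)

end Finite

theorem piece_top [FiniteDimensional F V] : piece S (⊤ : Submodule F V) = remainder S ⊤ := by
  have hproj : proj (⊤ : Submodule F V) = 1 := LinearMap.ext fun v => proj_of_mem trivial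
  have hZ : ∀ Z : extDiff (⊤ : Submodule F V), (Z : Module.End F V) = 0 := fun Z =>
    LinearMap.ext fun v => Z.2.1 v trivial
  have : Unique (extDiff (⊤ : Submodule F V)) := ⟨⟨0⟩, fun Z => Subtype.ext (hZ Z)⟩
  rw [piece_eq, avgExtend, finsum_unique, hZ, hproj]
  simp only [mul_one, add_zero]
  rw [Nat.card_unique, Nat.cast_one, Ring.inverse_one, one_smul]
  exact Finsupp.mapDomain_id

/-- **Kovács' theorem**, one-sided form: if the order of `F` is invertible in `S`, some element of
the semigroup algebra of square matrices is the identity up to singular matrices and is annihilated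
by right multiplication with matrices of deficient rank. -/
theorem exists_mul_eq_zero [Finite F] (hF : IsUnit (Nat.card F : S)) (n : ℕ) :
    ∃ u : Matrix (Fin n) (Fin n) F →₀ S,
      (∀ M ∈ (u - Finsupp.single 1 1).support, M.rank < n) ∧
      ∀ (m : ℕ) (A : Matrix (Fin n) (Fin m) F), A.rank < n → u.mapDomain (fun M => M * A) = 0 := by
  have htop : ∀ {W : Submodule F (Fin n → F)}, Module.finrank F W < n ↔ W < ⊤ := by
    intro W
    rw [lt_top_iff_ne_top]
    constructor
    · rintro h rfl
      simp at h
    · intro h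
      simpa using Submodule.finrank_lt h
  refine ⟨(piece S (⊤ : Submodule F (Fin n → F))).mapDomain LinearMap.toMatrix', ?_, ?_⟩
  · -- Modulo the identity, the piece of `⊤` is a combination of pieces of proper subspaces.
    intro M hM
    rw [← LinearMap.toMatrix'_one, ← Finsupp.mapDomain_single (f := LinearMap.toMatrix'),
      ← Finsupp.mapDomain_sub] at hM
    obtain ⟨N, hN, rfl⟩ := exists_of_mem_support_mapDomain hM
    rw [piece_top, remainder] at hN
    erw [sub_sub_cancel_left] at hN
    rw [Finsupp.support_neg] at hN
    obtain ⟨⟨W, hW⟩, hN⟩ := exists_of_mem_support_finsum hN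
    rw [Matrix.rank, ← Matrix.toLin'_apply', Matrix.toLin'_toMatrix', htop]
    refine hW.trans_le' ?_
    rintro _ ⟨v, rfl⟩
    exact mem_of_mem_support_piece W N hN v
  · intro m A hA
    have h := piece_comp_eq_zero (S := S) hF (Matrix.toLin' A) ⊤ (by
      rw [top_le_iff]
      exact (htop.1 hA).ne)
    rw [← Finsupp.mapDomain_comp]
    have := congrArg (Finsupp.mapDomain LinearMap.toMatrix') h
    rw [← Finsupp.mapDomain_comp, Finsupp.mapDomain_zero] at this
    rw [← this]
    congr 1
    ext1 M
    simp [LinearMap.toMatrix'_comp]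

/-- The transposed form of `exists_mul_eq_zero`. -/
theorem exists_mul_eq_zero' [Finite F] (hF : IsUnit (Nat.card F : S)) (n : ℕ) :
    ∃ u : Matrix (Fin n) (Fin n) F →₀ S,
      (∀ M ∈ (u - Finsupp.single 1 1).support, M.rank < n) ∧
      ∀ (m : ℕ) (A : Matrix (Fin m) (Fin n) F), A.rank < n → u.mapDomain (fun M => A * M) = 0 := by
  obtain ⟨u, h1, h2⟩ := exists_mul_eq_zero (F := F) hF n
  refine ⟨u.mapDomain Matrix.transpose, ?_, fun m A hA => ?_⟩
  · intro M hM
    rw [← Matrix.transpose_one, ← Finsupp.mapDomain_single (f := Matrix.transpose),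
      ← Finsupp.mapDomain_sub] at hM
    obtain ⟨N, hN, rfl⟩ := exists_of_mem_support_mapDomain hM
    rw [Matrix.rank_transpose]
    exact h1 N hN
  · have h := congrArg (Finsupp.mapDomain Matrix.transpose)
      (h2 m A.transpose (by rwa [Matrix.rank_transpose]))
    rw [← Finsupp.mapDomain_comp, Finsupp.mapDomain_zero] at h
    rw [← Finsupp.mapDomain_comp, ← h]
    congr 1
    ext1 M
    simp [Matrix.transpose_mul]

end Kovacs

/-! ### Rank factorization -/

theorem Matrix.exists_eq_mul_of_rank {F : Type*} [Field F] {l n : ℕ}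
    (A : Matrix (Fin l) (Fin n) F) :
    ∃ (P : Matrix (Fin l) (Fin A.rank) F) (Q : Matrix (Fin A.rank) (Fin n) F), A = P * Q := by
  have b : Module.Basis (Fin A.rank) F (LinearMap.range A.toLin') := Module.finBasis F _
  refine ⟨LinearMap.toMatrix' (Submodule.subtype _ ∘ₗ b.equivFun.symm.toLinearMap),
    LinearMap.toMatrix' (b.equivFun.toLinearMap ∘ₗ A.toLin'.rangeRestrict), ?_⟩
  rw [← LinearMap.toMatrix'_comp]
  refine (LinearMap.toMatrix'_toLin' A).symm.trans (congrArg LinearMap.toMatrix' ?_)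
  ext v
  simp

theorem Matrix.isUnit_of_rank_eq {F : Type*} [Field F] {n : ℕ} {A : Matrix (Fin n) (Fin n) F}
    (hA : A.rank = n) : IsUnit A := by
  rw [← Matrix.mulVec_surjective_iff_isUnit]
  have h : LinearMap.range A.mulVecLin = ⊤ :=
    Submodule.eq_top_of_finrank_eq (by simpa [Matrix.rank] using hA)
  exact LinearMap.range_eq_top.1 h

/-! ### Operations as functions of matrices -/

section Operations

variable {F : Type*} [Field F] {R : Type*} [Ring R] {B : Type*} [AddCommGroup B] [Module R B]
  {i k l m n : ℕ}

/-- The operation `X ↦ f (A X)`, where the arguments of an `n`-ary operation on `F ^ k` are the rows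
of the matrix `X`. -/
def Op.precomp (A : Matrix (Fin l) (Fin n) F) (f : Op (Fin k → F) B l) : Op (Fin k → F) B n :=
  fun X => f (Matrix.of.symm (A * Matrix.of X))

omit [AddCommGroup B] in
theorem Op.precomp_mul (A : Matrix (Fin l) (Fin m) F) (A' : Matrix (Fin m) (Fin n) F)
    (f : Op (Fin k → F) B l) : f.precomp (A * A') = (f.precomp A).precomp A' :=
  funext fun X => congrArg f (Matrix.mul_assoc A A' (Matrix.of X))

omit [AddCommGroup B] in
theorem Op.precomp_one (f : Op (Fin k → F) B n) : f.precomp (1 : Matrix (Fin n) (Fin n) F) = f :=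
  funext fun X => congrArg f (Matrix.one_mul (Matrix.of X))

omit [AddCommGroup B] in
theorem Op.comp_eq_precomp (f : Op (Fin k → F) B l) {g : Fin l → Op (Fin k → F) (Fin k → F) n}
    (hg : ∀ i, g i ∈ (termClone F (Fin k → F)).ops n) :
    ∃ A : Matrix (Fin l) (Fin n) F, f.comp g = f.precomp A := by
  choose A hA using fun i => (mem_termClone_iff F (Fin k → F) n (g i)).1 (hg i)
  refine ⟨Matrix.of A, funext fun X => congrArg f ?_⟩
  ext i j
  simp [Matrix.mul_apply, hA]

omit [AddCommGroup B] in
theorem Op.precomp_eq_comp (f : Op (Fin k → F) B l) (A : Matrix (Fin l) (Fin n) F) :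
    ∃ g : Fin l → Op (Fin k → F) (Fin k → F) n,
      (∀ i, g i ∈ (termClone F (Fin k → F)).ops n) ∧ f.precomp A = f.comp g := by
  refine ⟨fun i x => ∑ j, A i j • x j, fun i =>
    (mem_termClone_iff F (Fin k → F) n _).2 ⟨A i, fun _ => rfl⟩, funext fun X => congrArg f ?_⟩
  ext i j
  simp [Matrix.mul_apply]

/-- The action of a formal linear combination of square matrices on operations. The coefficients
lie in the center of `R`, so that the action is `R`-linear in the operation. -/
noncomputable def Op.twist (u : Matrix (Fin n) (Fin n) F →₀ Subring.center R)
    (f : Op (Fin k → F) B n) : Op (Fin k → F) B n :=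
  fun X => Finsupp.linearCombination (Subring.center R) (fun M => f.precomp M X) u

theorem Op.twist_add (u : Matrix (Fin n) (Fin n) F →₀ Subring.center R)
    (f g : Op (Fin k → F) B n) : (f + g).twist u = f.twist u + g.twist u := by
  funext X
  simp [Op.twist, Op.precomp, Finsupp.linearCombination_apply, Finsupp.sum_add]

theorem Op.twist_smul (u : Matrix (Fin n) (Fin n) F →₀ Subring.center R) (r : R)
    (f : Op (Fin k → F) B n) : (r • f).twist u = r • f.twist u := by
  funext X
  simp only [Op.twist, Op.precomp, Finsupp.linearCombination_apply, Pi.smul_apply,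
    Finsupp.smul_sum, smul_comm r]

theorem Op.twist_zero (u : Matrix (Fin n) (Fin n) F →₀ Subring.center R) :
    (0 : Op (Fin k → F) B n).twist u = 0 := by
  funext X
  simp [Op.twist, Op.precomp, Finsupp.linearCombination_apply]

theorem Op.twist_sub_left (u v : Matrix (Fin n) (Fin n) F →₀ Subring.center R)
    (f : Op (Fin k → F) B n) : f.twist (u - v) = f.twist u - f.twist v := by
  funext X
  simp [Op.twist]

theorem Op.twist_one (f : Op (Fin k → F) B n) :
    f.twist (Finsupp.single 1 1 : _ →₀ Subring.center R) = f := by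
  funext X
  simp [Op.twist, Op.precomp_one]

theorem Op.twist_eq_sum (u : Matrix (Fin n) (Fin n) F →₀ Subring.center R)
    (f : Op (Fin k → F) B n) :
    f.twist u = ∑ M ∈ u.support, (u M : R) • f.precomp M := by
  funext X
  simp [Op.twist, Finsupp.linearCombination_apply, Finsupp.sum, Subring.smul_def]

theorem Op.twist_apply_eq_zero {u : Matrix (Fin n) (Fin n) F →₀ Subring.center R}
    (f : Op (Fin k → F) B n) {X : Fin n → Fin k → F}
    (hu : u.mapDomain (fun M => M * Matrix.of X) = 0) : f.twist u X = 0 := by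
  have h := Finsupp.linearCombination_mapDomain (Subring.center R)
    (v' := fun Y => f (Matrix.of.symm Y)) (fun M => M * Matrix.of X) u
  rw [hu, map_zero] at h
  exact h.symm

theorem Op.twist_precomp_eq_zero {u : Matrix (Fin n) (Fin n) F →₀ Subring.center R}
    {A : Matrix (Fin l) (Fin n) F} (f : Op (Fin k → F) B l)
    (hu : u.mapDomain (fun M => A * M) = 0) : (f.precomp A).twist u = 0 := by
  funext X
  have h := Finsupp.linearCombination_mapDomain (Subring.center R)
    (v' := fun Y => f.precomp Y X) (fun M => A * M) u
  rw [hu, map_zero] at h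
  refine Eq.trans ?_ h.symm
  simp only [Op.twist, ← Op.precomp_mul]
  rfl

/-! ### Primitive operations and functions on full rank matrices -/

/-- An operation is primitive if it vanishes on all tuples of vectors that are linearly
dependent. -/
def Op.IsPrimitive (f : Op (Fin k → F) B n) : Prop :=
  ∀ X, (Matrix.of X).rank < n → f X = 0

theorem Op.IsPrimitive.precomp_eq_zero {f : Op (Fin k → F) B l} (hf : f.IsPrimitive)
    {A : Matrix (Fin l) (Fin n) F} (hA : A.rank < l) : f.precomp A = 0 :=
  funext fun X => hf _ (show (A * Matrix.of X).rank < l from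
    (Matrix.rank_mul_le_left A (Matrix.of X)).trans_lt hA)

theorem Op.IsPrimitive.twist_eq {u : Matrix (Fin n) (Fin n) F →₀ Subring.center R}
    (hu : ∀ M ∈ (u - Finsupp.single 1 1).support, M.rank < n)
    {f : Op (Fin k → F) B n} (hf : f.IsPrimitive) : f.twist u = f := by
  rw [← sub_eq_zero]
  nth_rw 2 [← Op.twist_one (R := R) f]
  rw [← Op.twist_sub_left, Op.twist_eq_sum]
  exact Finset.sum_eq_zero fun M hM => by rw [hf.precomp_eq_zero (hu M hM), smul_zero]

/-- The restriction of an operation to the matrices of full rank. -/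
def Op.restrict (f : Op (Fin k → F) B i) : FullRankFun F B i k := fun X => f (Matrix.of.symm X.1)

namespace FullRankFun

open Classical in
/-- The extension by zero of a function on full rank matrices. -/
noncomputable def extend (g : FullRankFun F B i k) : Op (Fin k → F) B i :=
  fun X => if h : (Matrix.of X).rank = i then g ⟨Matrix.of X, h⟩ else 0

theorem extend_of_rank_eq (g : FullRankFun F B i k) {X : Matrix (Fin i) (Fin k) F}
    (h : X.rank = i) : g.extend (Matrix.of.symm X) = g ⟨X, h⟩ :=
  dif_pos h

theorem extend_of_rank_ne (g : FullRankFun F B i k) {X : Matrix (Fin i) (Fin k) F}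
    (h : X.rank ≠ i) : g.extend (Matrix.of.symm X) = 0 :=
  dif_neg h

theorem extend_isPrimitive (g : FullRankFun F B i k) : g.extend.IsPrimitive :=
  fun _ hX => dif_neg hX.ne

theorem restrict_extend (g : FullRankFun F B i k) : g.extend.restrict = g :=
  funext fun X => dif_pos X.2

theorem extend_restrict {f : Op (Fin k → F) B i} (hf : f.IsPrimitive) : f.restrict.extend = f := by
  funext X
  by_cases h : (Matrix.of X).rank = i
  · exact dif_pos h
  · exact (dif_neg h).trans (hf X ((Matrix.rank_le_height _).lt_of_ne h)).symm

theorem extend_zero : (0 : FullRankFun F B i k).extend = 0 :=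
  funext fun _ => dite_eq_right_iff.2 fun _ => rfl

theorem extend_injective : Function.Injective (extend : FullRankFun F B i k → _) :=
  Function.LeftInverse.injective restrict_extend

theorem extend_add (g h : FullRankFun F B i k) : (g + h).extend = g.extend + h.extend := by
  funext X
  by_cases hX : (Matrix.of X).rank = i
  · simp only [extend, Pi.add_apply, dif_pos hX]
    rfl
  · simp only [extend, Pi.add_apply, dif_neg hX, add_zero]

theorem extend_single_smul (M : GL (Fin i) F) (r : R) (g : FullRankFun F B i k) :
    (((MonoidAlgebra.single M r : MonoidAlgebra R (GL (Fin i) F)) • g).extend) =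
      r • g.extend.precomp ((M⁻¹ : GL (Fin i) F) : Matrix (Fin i) (Fin i) F) := by
  funext X
  have hrank : ((M⁻¹ : GL (Fin i) F).1 * Matrix.of X).rank = (Matrix.of X).rank :=
    Matrix.rank_mul_eq_right_of_isUnit_det _ _ ((M⁻¹).isUnit.map Matrix.detMonoidHom)
  by_cases hX : (Matrix.of X).rank = i
  · refine (dif_pos hX).trans ((single_smul_apply M r g _).trans (congrArg (r • ·) ?_))
    exact (g.extend_of_rank_eq (hrank.trans hX)).symm
  · refine (dif_neg hX).trans ((smul_zero r).symm.trans (congrArg (r • ·) ?_))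
    exact (g.extend_of_rank_ne (hrank.trans_ne hX)).symm

theorem restrict_precomp_unit (M : GL (Fin i) F) (g : FullRankFun F B i k) :
    (g.extend.precomp (M : Matrix (Fin i) (Fin i) F)).restrict =
      (MonoidAlgebra.single M⁻¹ 1 : MonoidAlgebra R (GL (Fin i) F)) • g := by
  rw [← restrict_extend (_ • g), extend_single_smul, inv_inv, one_smul]

end FullRankFun

end Operations

/-! ### Clonoids and their primitive parts -/

namespace Clonoid

variable {F : Type*} [Field F] {R : Type*} [Ring R] {B : Type*} [AddCommGroup B] [Module R B]
  {k l n : ℕ}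

theorem linearCombination_mem (C : Clonoid (termClone F (Fin k → F)) (termClone R B))
    (r : Fin l → R) {f : Fin l → Op (Fin k → F) B n} (hf : ∀ i, f i ∈ C.ops n) :
    ∑ i, r i • f i ∈ C.ops n := by
  have h := C.comp_left l n (fun x => ∑ i, r i • x i) f
    ((mem_termClone_iff R B l _).2 ⟨r, fun _ => rfl⟩) hf
  convert h
  funext X
  simp [Op.comp]

/-- The `n`-ary members of a clonoid into an `R`-module, as an `R`-submodule. -/
def toSubmodule (C : Clonoid (termClone F (Fin k → F)) (termClone R B)) (n : ℕ) :
    Submodule R (Op (Fin k → F) B n) where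
  carrier := C.ops n
  zero_mem' := by simpa using C.linearCombination_mem (n := n) ![] (f := ![]) (by simp)
  add_mem' {f g} hf hg := by
    simpa using C.linearCombination_mem ![1, 1] (f := ![f, g]) (by simp [Fin.forall_fin_two, hf, hg])
  smul_mem' r f hf := by
    simpa using C.linearCombination_mem ![r] (f := ![f]) (by simp [hf])

theorem precomp_mem (C : Clonoid (termClone F (Fin k → F)) (termClone R B))
    {f : Op (Fin k → F) B l} (hf : f ∈ C.ops l) (A : Matrix (Fin l) (Fin n) F) :
    f.precomp A ∈ C.ops n := by
  obtain ⟨g, hg, h⟩ := f.precomp_eq_comp A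
  rw [h]
  exact C.comp_right n l f g hf hg

/-- A family of submodules that is closed under the substitutions `X ↦ A X` is a clonoid. -/
def ofSubmodules (S : ∀ n, Submodule R (Op (Fin k → F) B n))
    (hS : ∀ {l n : ℕ} (f : Op (Fin k → F) B l), f ∈ S l → ∀ A : Matrix (Fin l) (Fin n) F,
      f.precomp A ∈ S n) :
    Clonoid (termClone F (Fin k → F)) (termClone R B) where
  ops n := S n
  comp_left n m g f hg hf := by
    obtain ⟨r, hr⟩ := (mem_termClone_iff R B n g).1 hg
    have h := (S m).sum_mem fun i (_ : i ∈ Finset.univ) => (S m).smul_mem (r i) (hf i)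
    rwa [show ∑ i, r i • f i = g.comp f from funext fun X => by simp [Op.comp, hr]] at h
  comp_right n m f g hf hg := by
    obtain ⟨A, hA⟩ := f.comp_eq_precomp hg
    rw [hA]
    exact hS f hf A

theorem mem_ofSubmodules {S : ∀ n, Submodule R (Op (Fin k → F) B n)}
    {hS : ∀ {l n : ℕ} (f : Op (Fin k → F) B l), f ∈ S l → ∀ A : Matrix (Fin l) (Fin n) F,
      f.precomp A ∈ S n} {f : Op (Fin k → F) B n} :
    f ∈ (ofSubmodules S hS).ops n ↔ f ∈ S n :=
  Iff.rfl

theorem twist_mem (C : Clonoid (termClone F (Fin k → F)) (termClone R B))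
    {f : Op (Fin k → F) B n} (hf : f ∈ C.ops n)
    (u : Matrix (Fin n) (Fin n) F →₀ Subring.center R) : f.twist u ∈ C.ops n := by
  rw [Op.twist_eq_sum]
  exact (C.toSubmodule n).sum_mem fun M _ => (C.toSubmodule n).smul_mem _ (C.precomp_mem hf M)

/-- The functions on full rank `i × k` matrices whose extensions by zero belong to the
clonoid. -/
noncomputable def primitivePart (C : Clonoid (termClone F (Fin k → F)) (termClone R B)) (i : ℕ) :
    Submodule (MonoidAlgebra R (GL (Fin i) F)) (FullRankFun F B i k) where
  carrier := {g | g.extend ∈ C.toSubmodule i}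
  zero_mem' := by
    rw [Set.mem_ofPred_eq, FullRankFun.extend_zero]
    exact zero_mem _
  add_mem' {g h} hg hh := by
    rw [Set.mem_ofPred_eq, FullRankFun.extend_add]
    exact add_mem hg hh
  smul_mem' a g hg := by
    rw [Set.mem_ofPred_eq]
    induction a using MonoidAlgebra.induction_linear with
    | zero => rw [zero_smul, FullRankFun.extend_zero]; exact zero_mem _
    | add a b ha hb => rw [add_smul, FullRankFun.extend_add]; exact add_mem ha hb
    | single M r =>
      rw [FullRankFun.extend_single_smul]
      exact Submodule.smul_mem _ _ (C.precomp_mem hg _)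

theorem mem_primitivePart {C : Clonoid (termClone F (Fin k → F)) (termClone R B)} {i : ℕ}
    {g : FullRankFun F B i k} : g ∈ C.primitivePart i ↔ g.extend ∈ C.ops i :=
  Iff.rfl

theorem primitivePart_mono {C D : Clonoid (termClone F (Fin k → F)) (termClone R B)} (h : C ≤ D)
    (i : ℕ) : C.primitivePart i ≤ D.primitivePart i :=
  fun _ hg => h i hg

omit [Field F] in
theorem isUnit_card_center (hF : IsUnit (Nat.card F : R)) :
    IsUnit (Nat.card F : Subring.center R) := by
  obtain ⟨q, hq⟩ := hF
  refine IsUnit.of_mul_eq_one ⟨((q⁻¹ : Rˣ) : R), Set.units_inv_mem_center ?_⟩ ?_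
  · rw [hq]
    exact natCast_mem (Subring.center R) _
  · apply Subtype.ext
    simp [← hq]

/-! ### The lattice isomorphism -/

/-- A clonoid is determined by its primitive parts: up to operations obtained from smaller arities,
every member is a primitive member. -/
theorem le_of_primitivePart_le [Finite F] (hF : IsUnit (Nat.card F : R))
    {C D : Clonoid (termClone F (Fin k → F)) (termClone R B)}
    (h : ∀ i ≤ k, C.primitivePart i ≤ D.primitivePart i) : C ≤ D := by
  intro n
  induction n using Nat.strong_induction_on with
  | h n ih =>
  intro f hf
  obtain ⟨u, hu, hu0⟩ := Kovacs.exists_mul_eq_zero (F := F) (isUnit_card_center hF) n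
  have hprim : (f.twist u).IsPrimitive := fun X hX => Op.twist_apply_eq_zero f (hu0 k _ hX)
  have htwist : f.twist u ∈ D.toSubmodule n := by
    rcases le_or_gt n k with hn | hn
    · have hmem : (f.twist u).restrict ∈ C.primitivePart n := by
        rw [mem_primitivePart, FullRankFun.extend_restrict hprim]
        exact C.twist_mem hf u
      have := h n hn hmem
      rwa [mem_primitivePart, FullRankFun.extend_restrict hprim] at this
    · have : f.twist u = 0 := funext fun X =>
        hprim X ((Matrix.rank_le_width (Matrix.of X)).trans_lt hn)
      rw [this]
      exact zero_mem _
  have hrest : f.twist (u - Finsupp.single 1 1) ∈ D.toSubmodule n := by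
    rw [Op.twist_eq_sum]
    refine sum_mem fun M hM => Submodule.smul_mem _ _ ?_
    obtain ⟨P, Q, hPQ⟩ := M.exists_eq_mul_of_rank
    rw [hPQ, Op.precomp_mul]
    exact D.precomp_mem (ih _ (hu M hM) (C.precomp_mem hf P)) Q
  have heq : f = f.twist u - f.twist (u - Finsupp.single 1 1) := by
    rw [Op.twist_sub_left, Op.twist_one, sub_sub_cancel]
  rw [heq]
  exact sub_mem htwist hrest

/-- Every family of submodules consists of the primitive parts of a clonoid: the clonoid of all
operations whose minors of arity `i` have a primitive component in the `i`-th submodule. -/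
theorem exists_primitivePart_eq [Finite F] (hF : IsUnit (Nat.card F : R))
    (N : (i : Fin (k + 1)) → Submodule (MonoidAlgebra R (GL (Fin i) F)) (FullRankFun F B i k)) :
    ∃ C : Clonoid (termClone F (Fin k → F)) (termClone R B),
      ∀ i : Fin (k + 1), C.primitivePart i = N i := by
  choose u hu hu0 using Kovacs.exists_mul_eq_zero' (F := F) (isUnit_card_center hF)
  have hsmul : ∀ (i : Fin (k + 1)) (r : R) (g : FullRankFun F B i k), g ∈ N i → r • g ∈ N i := by
    intro i r g hg
    have : r • g = (MonoidAlgebra.single 1 r : MonoidAlgebra R (GL (Fin i) F)) • g := by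
      funext X
      rw [FullRankFun.single_smul_apply, inv_one]
      exact congrArg (r • g ·) (Subtype.ext (Matrix.one_mul X.1).symm)
    rw [this]
    exact (N i).smul_mem _ hg
  refine ⟨ofSubmodules (fun n =>
    { carrier := {f | ∀ (i : Fin (k + 1)) (A : Matrix (Fin n) (Fin i) F),
        ((f.precomp A).twist (u i)).restrict ∈ N i}
      zero_mem' := fun i A => ?_
      add_mem' := fun {f g} hf hg i A => ?_
      smul_mem' := fun r f hf i A => ?_ }) fun f hf A i A' => ?_, fun i => ?_⟩
  · rw [show (f + g).precomp A = f.precomp A + g.precomp A from rfl, Op.twist_add]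
    exact (N i).add_mem (hf i A) (hg i A)
  · rw [show (0 : Op (Fin k → F) B n).precomp A = 0 from rfl, Op.twist_zero]
    exact (N i).zero_mem
  · rw [show (r • f).precomp A = r • f.precomp A from rfl, Op.twist_smul]
    exact hsmul i r _ (hf i A)
  · rw [← Op.precomp_mul]
    exact hf i (A * A')
  · ext g
    rw [mem_primitivePart, mem_ofSubmodules]
    constructor
    · intro hg
      have := hg i 1
      rwa [Op.precomp_one, g.extend_isPrimitive.twist_eq (hu i),
        FullRankFun.restrict_extend] at this
    · -- Only minors of the operation `g` by invertible matrices have a primitive component.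
      intro hg j A
      rcases (Matrix.rank_le_height A).lt_or_eq with hA | hA
      · rw [g.extend_isPrimitive.precomp_eq_zero hA, Op.twist_zero]
        exact (N j).zero_mem
      rcases (hA.symm.le.trans (Matrix.rank_le_width A)).lt_or_eq with hij | hij
      · rw [Op.twist_precomp_eq_zero _ (hu0 j i A (hA.trans_lt hij))]
        exact (N j).zero_mem
      obtain rfl : i = j := Fin.ext hij
      obtain ⟨M, rfl⟩ := Matrix.isUnit_of_rank_eq hA
      have hprim : (g.extend.precomp (M : Matrix (Fin i) (Fin i) F)).IsPrimitive := by
        rw [← one_smul R (g.extend.precomp _), ← inv_inv M, ← FullRankFun.extend_single_smul]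
        exact FullRankFun.extend_isPrimitive _
      rw [hprim.twist_eq (hu i), FullRankFun.restrict_precomp_unit (R := R)]
      exact (N i).smul_mem _ hg

/-! ### Generation by minors -/

/-- If the primitive parts of a clonoid above `j` vanish, then its members are generated by their
`j`-ary minors. -/
theorem generatedByMinors_of_primitivePart_eq_bot [Finite F] (hF : IsUnit (Nat.card F : R))
    {C : Clonoid (termClone F (Fin k → F)) (termClone R B)} {j : ℕ}
    (hC : ∀ i ≤ k, j < i → C.primitivePart i = ⊥) {f : Op (Fin k → F) B n} (hf : f ∈ C.ops n) :
    GeneratedByMinors (termClone F (Fin k → F)) (termClone R B) j f := by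
  set D := generate (termClone F (Fin k → F)) (termClone R B)
    (minors (termClone F (Fin k → F)) j f) with hD
  -- `K` is the largest clonoid whose members of arity at most `j` belong to `D`.
  let K : Clonoid (termClone F (Fin k → F)) (termClone R B) := ofSubmodules (fun n =>
    { carrier := {h | ∀ m ≤ j, ∀ A : Matrix (Fin n) (Fin m) F, h.precomp A ∈ D.toSubmodule m}
      zero_mem' := fun m _ A => (D.toSubmodule m).zero_mem
      add_mem' := fun hg hh m hm A => (D.toSubmodule m).add_mem (hg m hm A) (hh m hm A)
      smul_mem' := fun r h hh m hm A => (D.toSubmodule m).smul_mem r (hh m hm A) })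
    fun h hh A m hm A' => by
      rw [← Op.precomp_mul]
      exact hh m hm _
  have hfK : f ∈ K.ops n := by
    intro m hm A
    -- The matrix `A` factors through arity `j`.
    let E : Matrix (Fin m) (Fin j) F := (1 : Matrix (Fin j) (Fin j) F).submatrix (Fin.castLE hm) id
    let E' : Matrix (Fin j) (Fin m) F :=
      (1 : Matrix (Fin j) (Fin j) F).submatrix id (Fin.castLE hm)
    have hE : E * E' = 1 := by
      rw [← Matrix.submatrix_mul _ _ _ _ _ Function.bijective_id, Matrix.one_mul,
        Matrix.submatrix_one _ (Fin.castLE_injective hm)]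
    rw [← A.mul_one, ← hE, ← Matrix.mul_assoc, Op.precomp_mul]
    refine D.precomp_mem ?_ E'
    obtain ⟨v, hv, h⟩ := f.precomp_eq_comp (A * E)
    exact fun D' hD' => hD' j ⟨rfl, v, hv, h⟩
  have hle : C ⊓ K ≤ D := by
    refine le_of_primitivePart_le hF fun i hi => ?_
    rcases le_or_gt i j with hij | hij
    · intro g hg
      have := (mem_primitivePart.1 hg).2 i hij 1
      rwa [Op.precomp_one] at this
    · refine (primitivePart_mono inf_le_left i).trans ?_
      rw [hC i hi hij]
      exact bot_le
  exact hle n ⟨hf, hfK⟩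

/-- A primitive operation of arity larger than `j` has no nonzero `j`-ary minors. -/
theorem _root_.Op.IsPrimitive.eq_zero_of_generatedByMinors {f : Op (Fin k → F) B n}
    (hf : f.IsPrimitive) {j : ℕ} (hj : j < n)
    (h : GeneratedByMinors (termClone F (Fin k → F)) (termClone R B) j f) : f = 0 := by
  refine h (ofSubmodules (fun _ => ⊥) ?_) ?_
  · rintro l n _ rfl A
    exact Submodule.zero_mem _
  · rintro m _ ⟨rfl, v, hv, rfl⟩
    obtain ⟨A, hA⟩ := f.comp_eq_precomp hv
    rw [hA]
    exact hf.precomp_eq_zero ((Matrix.rank_le_width A).trans_lt hj)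

end Clonoid

theorem mainTheorem4 {F : Type*} [Field F] [Finite F] {R : Type*} [Ring R]
    {B : Type*} [AddCommGroup B] [Module R B] (k : ℕ) (hF : IsUnit (Nat.card F : R)) :
    ∃ Φ : Clonoid (termClone F (Fin k → F)) (termClone R B) ≃o
        ((i : Fin (k + 1)) →
          Submodule (MonoidAlgebra R (GL (Fin i) F)) (FullRankFun F B i k)),
      ∀ j : ℕ, j ≤ k → ∀ C : Clonoid (termClone F (Fin k → F)) (termClone R B),
        (∀ (n : ℕ), ∀ f ∈ C.ops n,
            GeneratedByMinors (termClone F (Fin k → F)) (termClone R B) j f) ↔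
          ∀ i : Fin (k + 1), j < (i : ℕ) → Φ C i = ⊥ := by
  let Φ : Clonoid (termClone F (Fin k → F)) (termClone R B) ↪o
      ((i : Fin (k + 1)) →
        Submodule (MonoidAlgebra R (GL (Fin i) F)) (FullRankFun F B i k)) :=
    OrderEmbedding.ofMapLEIff (fun C i => C.primitivePart i) fun C D =>
      ⟨fun h => Clonoid.le_of_primitivePart_le hF fun i hi => h ⟨i, Nat.lt_succ_of_le hi⟩,
        fun h i => Clonoid.primitivePart_mono h i⟩
  refine ⟨RelIso.ofSurjective Φ fun N => ?_, fun j _ C => ⟨fun hC i hij => ?_, fun hC n f hf => ?_⟩⟩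
  · obtain ⟨C, hC⟩ := Clonoid.exists_primitivePart_eq hF N
    exact ⟨C, funext hC⟩
  · change C.primitivePart i = ⊥
    refine (Submodule.eq_bot_iff _).2 fun g hg => FullRankFun.extend_injective ?_
    rw [FullRankFun.extend_zero]
    exact g.extend_isPrimitive.eq_zero_of_generatedByMinors hij (hC i _ hg)
  · exact Clonoid.generatedByMinors_of_primitivePart_eq_bot hF
      (fun i hi hij => hC ⟨i, Nat.lt_succ_of_le hi⟩ hij) hf
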